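/- Let $(E,\rho)$ be a separable complete metric space with Borel $\sigma$-algebra $\mathcal E$. Let $d$ be another metric on $E$, bounded and continuous with respect to $\rho$ (not necessarily complete), such that for every $y\in E$ there is a sequence of $d$-continuous functions $\rho^y_n$ from the $d$-completion $\overline E^d$ of $E$ to $[0,\infty)$ with $\rho^y_n(x)\to\rho(x,y)$ for $x\in E$ and $\rho^y_n(x)\to\infty$ for $x\in\overline E^d\setminus E$. (One may take $d=\rho$ if $\rho$ is bounded.) Let $P(x,dy)$ be a Markov transition kernel on $(E,\mathcal E)$, let $\mathbb P_\mu$ denote the law on $E^\infty=E^{\{0,1,2,\dots\}}$ of the time-homogeneous Markov chain $X=(X_n)_{n\ge0}$ with transition kernel $P$ and initial law $\mu$, and let $\mathbb P_x=\mathbb P_{\delta_x}$. For probability measures $\mathbb P,\mathbb Q$ on $E^\infty$, let $C(\mathbb P,\mathbb Q)$, respectively $\widehat C(\mathbb P,\mathbb Q)$, be the set of probability measures $\xi$ on $E^\infty\times E^\infty$ whose marginals satisfy $\pi_1(\xi)=\mathbb P$, $\pi_2(\xi)=\mathbb Q$, respectively $\pi_1(\xi)\ll\mathbb P$, $\pi_2(\xi)\ll\mathbb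 Q$. For $p>1$, $R\ge1$, let $\widehat C^R_p(\mathbb P,\mathbb Q)$ be the set of $\xi\in\widehat C(\mathbb P,\mathbb Q)$ such that $\frac{d\pi_1(\xi)}{d\mathbb P}$ and $\frac{d\pi_2(\xi)}{d\mathbb Q}$ have norm at most $R$ in $L^p(\mathbb P)$ and $L^p(\mathbb Q)$, respectively. Write $(X_n,Y_n)_{n\ge0}$ for the coordinates on $E^\infty\times E^\infty$. Assume that $X$ is $d$-Feller, that is, $x\mapsto\int f(y)\,P(x,dy)$ is $d$-continuous for every bounded $d$-continuous $f:E\to\mathbb R$. Let $\mu$ be an invariant probability measure, and let $M\in\mathcal E\otimes\mathcal E$ be such that $(\mu\otimes\mu)(M)=1$ and for each $(x,y)\in M$ at least one of the following conditions holds: (i) $\displaystyle\lim_{\varepsilon\downarrow0}\liminf_{n\to\infty}\sup_{\xi\in C(\mathbb P_x,\mathbb P_y)}\xi\big(d(X_n,Y_n)\le\varepsilon\big)>0$; (ii) for some $p>1$ and $R\ge1$, $\displaystyle\lim_{\varepsilon\downarrow0}\liminf_{n\to\infty}\sup_{\xi\in\widehat C^R_p(\mathbb P_x,\mathbb P_y)}\xi\big(d(X_n,Y_n)\le\varepsilon\big)>0$;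 (iii) $\displaystyle\sup_{\xi\in\widehat C(\mathbb P_x,\mathbb P_y)}\lim_{\varepsilon\downarrow0}\liminf_{n\to\infty}\xi\big(d(X_n,Y_n)\le\varepsilon\big)>0$. Then $X$ is mixing under $\mathbb P_\mu$: it is strictly stationary under $\mathbb P_\mu$, and for all bounded measurable functions $f,g:E\to\mathbb R$, $$\mathbb E_\mu\big[f(X_0)g(X_n)\big]\to\mathbb E_\mu f(X_0)\cdot\mathbb E_\mu g(X_0),\qquad n\to\infty.$$ -/

import Mathlib

open MeasureTheory ProbabilityTheory Filter Topology
open scoped ENNReal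

namespace GenCoupling

/-! ### A second metric on a given set -/

section Metric

/-- `d` is a metric on the set `E`. It is kept as a plain function, since `E` already carries
another metric `ρ`, given by a `MetricSpace` instance. -/
structure IsMetric {E : Type*} (d : E → E → ℝ) : Prop where
  self : ∀ x, d x x = 0
  eq_of : ∀ x y, d x y = 0 → x = y
  symm : ∀ x y, d x y = d y x
  triangle : ∀ x y z, d x z ≤ d x y + d y z

/-- The metric space `(E, d)`: a copy of `E` whose metric, uniformity and topology are those of
`d`. -/
def IsMetric.Space {E : Type*} {d : E → E → ℝ} (_ : IsMetric d) : Type _ := E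

instance {E : Type*} {d : E → E → ℝ} (hd : IsMetric d) : MetricSpace hd.Space where
  dist := d
  dist_self := hd.self
  dist_comm := hd.symm
  dist_triangle := hd.triangle
  eq_of_dist_eq_zero := fun {x y} h => hd.eq_of x y h

/-- The identity map from `E` to its copy `(E, d)`. -/
def IsMetric.equiv {E : Type*} {d : E → E → ℝ} (hd : IsMetric d) : E ≃ hd.Space := Equiv.refl E

/-- For every `y` in `E` there are `d`-continuous functions `r 0, r 1, …`, with values in
`[0, ∞)`, on the `d`-completion of `E`, which converge pointwise to `ρ (·, y)` on `E` and to `∞`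
off `E`. Here `ρ = dist` is the metric of the `MetricSpace` instance. -/
def ApproxOnCompletion {E : Type*} [MetricSpace E] {d : E → E → ℝ} (hd : IsMetric d) : Prop :=
  ∀ y : E, ∃ r : ℕ → UniformSpace.Completion hd.Space → ℝ,
    (∀ n, Continuous (r n)) ∧ (∀ n z, 0 ≤ r n z) ∧
    (∀ x : E, Tendsto (fun n => r n (hd.equiv x : UniformSpace.Completion hd.Space)) atTop
      (𝓝 (dist x y))) ∧
    ∀ z : UniformSpace.Completion hd.Space,
      z ∉ Set.range ((↑) : hd.Space → UniformSpace.Completion hd.Space) →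
        Tendsto (fun n => r n z) atTop atTop

/-- The transition kernel `P` is `d`-Feller: it maps bounded `d`-continuous functions to
`d`-continuous functions. -/
def IsFeller {E : Type*} [MeasurableSpace E] {d : E → E → ℝ} (hd : IsMetric d)
    (P : Kernel E E) : Prop :=
  ∀ f : hd.Space → ℝ, Continuous f → (∃ C, ∀ x, |f x| ≤ C) →
    Continuous fun x : hd.Space => ∫ y, f (hd.equiv y) ∂(P (hd.equiv.symm x))

end Metric

/-! ### Laws of Markov chains -/

section Chain

/-- The law, on the space `ℕ → E` of trajectories, of the time-homogeneous Markov chain with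
initial distribution `μ` and transition kernel `P`. -/
noncomputable def chainLaw {E : Type*} [MeasurableSpace E] (P : Kernel E E) [IsMarkovKernel P]
    (μ : Measure E) [IsProbabilityMeasure μ] : Measure (ℕ → E) :=
  Kernel.trajMeasure (X := fun _ => E) μ fun n =>
    P.comap (fun h : (i : Finset.Iic n) → E => h ⟨n, Finset.mem_Iic.2 le_rfl⟩)
      (measurable_pi_apply _)

/-- The law of the chain started at the point `x`. -/
noncomputable def chainLawFrom {E : Type*} [MeasurableSpace E] (P : Kernel E E)
    [IsMarkovKernel P] (x : E) : Measure (ℕ → E) :=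
  chainLaw P (Measure.dirac x)

/-- A sequence `ζ` of random elements is strictly stationary: all its time shifts have the same
law. -/
def IsStrictlyStationary {Ω E : Type*} [MeasurableSpace Ω] [MeasurableSpace E]
    (ζ : ℕ → Ω → E) (Q : Measure Ω) : Prop :=
  ∀ k : ℕ, Q.map (fun ω n => ζ (n + k) ω) = Q.map (fun ω n => ζ n ω)

/-- A sequence `ζ` of random elements is mixing: it is strictly stationary, and
`E f(ζ₀) g(ζₙ) → E f(ζ₀) · E g(ζ₀)` for all bounded measurable functions `f`, `g`. -/
def IsMixing {Ω E : Type*} [MeasurableSpace Ω] [MeasurableSpace E]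
    (ζ : ℕ → Ω → E) (Q : Measure Ω) : Prop :=
  IsStrictlyStationary ζ Q ∧
    ∀ f g : E → ℝ, Measurable f → Measurable g →
      (∃ C, ∀ x, |f x| ≤ C) → (∃ C, ∀ x, |g x| ≤ C) →
      Tendsto (fun n => ∫ ω, f (ζ 0 ω) * g (ζ n ω) ∂Q) atTop
        (𝓝 ((∫ ω, f (ζ 0 ω) ∂Q) * ∫ ω, g (ζ 0 ω) ∂Q))

end Chain

/-! ### Couplings and generalized couplings -/

section Coupling

/-- The set `C(μ, ν)` of couplings. -/
def couplings {S : Type*} [MeasurableSpace S] (μ ν : Measure S) : Set (Measure (S × S)) :=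
  {ξ | IsProbabilityMeasure ξ ∧ ξ.fst = μ ∧ ξ.snd = ν}

/-- The set `Ĉ(μ, ν)` of generalized couplings, with marginals absolutely continuous with respect
to `μ` and `ν`. -/
def genCouplings {S : Type*} [MeasurableSpace S] (μ ν : Measure S) : Set (Measure (S × S)) :=
  {ξ | IsProbabilityMeasure ξ ∧ ξ.fst ≪ μ ∧ ξ.snd ≪ ν}

/-- The set `Ĉ_p^R(μ, ν)` of generalized couplings whose marginals have densities of `L^p` norm
at most `R` with respect to `μ` and `ν`. -/
def genCouplingsLp {S : Type*} [MeasurableSpace S] (p R : ℝ) (μ ν : Measure S) :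
    Set (Measure (S × S)) :=
  {ξ | ξ ∈ genCouplings μ ν ∧
    (∫⁻ s, ξ.fst.rnDeriv μ s ^ p ∂μ) ^ (1 / p) ≤ ENNReal.ofReal R ∧
    (∫⁻ s, ξ.snd.rnDeriv ν s ^ p ∂ν) ^ (1 / p) ≤ ENNReal.ofReal R}

/-- The event `d (Xₙ, Yₙ) ≤ ε` on the space of pairs of trajectories. -/
def closeAt {E : Type*} (d : E → E → ℝ) (n : ℕ) (ε : ℝ) : Set ((ℕ → E) × (ℕ → E)) :=
  {ω | d (ω.1 n) (ω.2 n) ≤ ε}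

/-- `lim_{ε ↓ 0} F ε > 0`, for a function `F` with values in `[0, ∞]`. -/
def HasPosLimitAtZero (F : ℝ → ℝ≥0∞) : Prop :=
  ∃ l : ℝ≥0∞, 0 < l ∧ Tendsto F (𝓝[>] (0 : ℝ)) (𝓝 l)

variable {E : Type*} [MeasurableSpace E]

/-- `lim_{ε ↓ 0} liminf_n sup_{ξ ∈ C(P_x, P_y)} ξ(d(Xₙ, Yₙ) ≤ ε) > 0`. -/
def CouplingCond (d : E → E → ℝ) (P : Kernel E E) [IsMarkovKernel P] (x y : E) : Prop :=
  HasPosLimitAtZero fun ε =>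
    liminf (fun n => ⨆ ξ ∈ couplings (chainLawFrom P x) (chainLawFrom P y), ξ (closeAt d n ε))
      atTop

/-- For some `p > 1` and `R ≥ 1`,
`lim_{ε ↓ 0} liminf_n sup_{ξ ∈ Ĉ_p^R(P_x, P_y)} ξ(d(Xₙ, Yₙ) ≤ ε) > 0`. -/
def GenCouplingLpCond (d : E → E → ℝ) (P : Kernel E E) [IsMarkovKernel P] (x y : E) : Prop :=
  ∃ p R : ℝ, 1 < p ∧ 1 ≤ R ∧ HasPosLimitAtZero fun ε =>
    liminf (fun n => ⨆ ξ ∈ genCouplingsLp p R (chainLawFrom P x) (chainLawFrom P y),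
      ξ (closeAt d n ε)) atTop

/-- `sup_{ξ ∈ Ĉ(P_x, P_y)} lim_{ε ↓ 0} liminf_n ξ(d(Xₙ, Yₙ) ≤ ε) > 0`, that is, the limit is
positive for some `ξ`. -/
def GenCouplingCond (d : E → E → ℝ) (P : Kernel E E) [IsMarkovKernel P] (x y : E) : Prop :=
  ∃ ξ ∈ genCouplings (chainLawFrom P x) (chainLawFrom P y), HasPosLimitAtZero fun ε =>
    liminf (fun n => ξ (closeAt d n ε)) atTop

end Coupling

end GenCoupling

/-! Let `T` be the transition operator on `L²(μ)`, a contraction, so that `⟪f, Tⁿ g⟫ = E f(X₀)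
g(Xₙ)`. Mixing says that `Tⁿ g` tends weakly to the constant `∫ g dμ`, and it is enough to identify
every weak limit `z` along an ultrafilter.

Such a `z` satisfies `‖Tᵏ z‖ = ‖z‖` for all `k` (`exists_weak_limit_isometric`): the norms `‖Tⁿ g‖`
decrease to a limit, so `T*ᵏ Tᵏ` asymptotically fixes the orbit and hence fixes `z`. Since `Tⁿ z
(X₀)` is the conditional expectation of `z(Xₙ)` given `X₀`, equality of norms forces `z(Xₙ) =
wₙ(X₀)` almost surely, with `wₙ = Tⁿ z` (`eval_ae_eq_of_norm_eq`). Thus `z(Xₙ)` is deterministic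
under `P_x` for almost every `x`.

Couplings then make `z` constant. Off a set of small measure, `z` is `d`-uniformly continuous up to
`δ`. For most pairs `(x, y)` some generalized coupling puts `Xₙ` and `Yₙ` close together and outside
that set with positive probability, so the deterministic values `wₙ(x)`, `wₙ(y)` differ by at most
`δ` (`CloseAtTime.abs_sub_le`). By stationarity `wₙ` and `z` have the same law under `μ`, so the
estimate passes to `z` (`prod_measure_lt_abs_sub_le`). Since `T` preserves integrals, the constant
is `∫ g dμ`. -/

namespace GenCoupling

open Preorder

/-! ### The Markov property and stationarity of the chain -/

section ChainFacts

theorem map_compProd_comap {A B C : Type*} [MeasurableSpace A] [MeasurableSpace B]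
    [MeasurableSpace C] (ν : Measure A) [SFinite ν] (κ : Kernel B C) [IsSFiniteKernel κ]
    {φ : A → B} (hφ : Measurable φ) :
    (ν ⊗ₘ κ.comap φ hφ).map (Prod.map φ id) = ν.map φ ⊗ₘ κ := by
  ext s hs
  rw [Measure.map_apply (by fun_prop) hs, Measure.compProd_apply (hs.preimage (by fun_prop)),
    Measure.compProd_apply hs, lintegral_map (Kernel.measurable_kernel_prodMk_left hs) hφ]
  rfl

/-- Two finite measures on sequences with the same laws of initial segments coincide. -/
theorem measure_ext_frestrictLe {E : Type*} [MeasurableSpace E] {Q Q' : Measure (ℕ → E)}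
    [IsFiniteMeasure Q] [IsFiniteMeasure Q']
    (h : ∀ n, Q.map (frestrictLe (π := fun _ => E) n) = Q'.map (frestrictLe n)) : Q = Q' := by
  have hp : IsProjectiveMeasureFamily (α := fun _ => E)
      (fun I : Finset ℕ => Q'.map (I.restrict (π := fun _ => E))) := by
    intro I J hJI
    rw [Measure.map_map (Finset.measurable_restrict₂ hJI) (Finset.measurable_restrict I)]
    rfl
  have h1 : IsProjectiveLimit (α := fun _ => E) Q
      (fun I : Finset ℕ => Q'.map (I.restrict (π := fun _ => E))) :=
    (isProjectiveLimit_nat_iff (X := fun _ => E) hp Q).2 h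
  have h2 : IsProjectiveLimit (α := fun _ => E) Q'
      (fun I : Finset ℕ => Q'.map (I.restrict (π := fun _ => E))) :=
    fun _ => rfl
  exact h1.unique h2

variable {E : Type*} [MeasurableSpace E] (P : Kernel E E) [IsMarkovKernel P]

theorem measurable_last (n : ℕ) :
    Measurable fun h : (Finset.Iic n) → E => h ⟨n, Finset.mem_Iic.2 le_rfl⟩ :=
  measurable_pi_apply _

/-- The kernel which sends `x` to the law of the chain started at `x`. -/
noncomputable def chainKernel : Kernel E (ℕ → E) :=
  (Kernel.traj (X := fun _ => E) (fun n => P.comap _ (measurable_last n)) 0).comap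
    (MeasurableEquiv.piUnique (fun _ : Finset.Iic 0 => E)).symm (MeasurableEquiv.measurable _)

instance : IsMarkovKernel (chainKernel P) := by unfold chainKernel; infer_instance

instance (μ : Measure E) [IsProbabilityMeasure μ] : IsProbabilityMeasure (chainLaw P μ) := by
  unfold chainLaw; infer_instance

instance (x : E) : IsProbabilityMeasure (chainLawFrom P x) := by
  unfold chainLawFrom; infer_instance

theorem chainLaw_eq_comp (μ : Measure E) [IsProbabilityMeasure μ] :
    chainLaw P μ = chainKernel P ∘ₘ μ := by
  unfold chainLaw Kernel.trajMeasure chainKernel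
  ext s hs
  rw [Measure.bind_apply hs (by fun_prop), Measure.bind_apply hs (by fun_prop),
    lintegral_map (Kernel.measurable_coe _ hs) (by fun_prop)]
  rfl

theorem chainLawFrom_eq (x : E) : chainLawFrom P x = chainKernel P x := by
  rw [chainLawFrom, chainLaw_eq_comp, Measure.dirac_bind (by fun_prop)]

theorem chainLaw_map_zero (μ : Measure E) [IsProbabilityMeasure μ] :
    (chainLaw P μ).map (fun ω => ω 0) = μ := by
  have h1 : (chainLaw P μ).map (frestrictLe (π := fun _ => E) 0) =
      μ.map (MeasurableEquiv.piUnique (fun _ : Finset.Iic 0 => E)).symm := by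
    rw [chainLaw, Kernel.trajMeasure, Measure.map_comp _ _ (by fun_prop),
      Kernel.traj_map_frestrictLe, Kernel.partialTraj_self, Measure.id_comp]
  have h2 : (fun ω : ℕ → E => ω 0) =
      (MeasurableEquiv.piUnique (fun _ : Finset.Iic 0 => E)) ∘ frestrictLe (π := fun _ => E) 0 := by
    ext ω; rfl
  rw [h2, ← Measure.map_map (by fun_prop) (by fun_prop), h1,
    Measure.map_map (by fun_prop) (by fun_prop), MeasurableEquiv.self_comp_symm, Measure.map_id]

theorem ae_chainLawFrom_zero [MeasurableSingletonClass E] (x : E) :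
    ∀ᵐ ω ∂(chainLawFrom P x), ω 0 = x := by
  have h : ∀ᵐ y ∂((chainLawFrom P x).map fun ω => ω 0), y = x := by
    rw [chainLawFrom, chainLaw_map_zero, ae_dirac_eq]
    rfl
  exact ae_of_ae_map (measurable_pi_apply 0).aemeasurable h

theorem chainLaw_map_succ (μ : Measure E) [IsProbabilityMeasure μ] (n : ℕ) :
    (chainLaw P μ).map (fun ω => (frestrictLe (π := fun _ => E) n ω, ω (n + 1))) =
      (chainLaw P μ).map (frestrictLe n) ⊗ₘ P.comap _ (measurable_last n) :=
  (Kernel.map_frestrictLe_trajMeasure_compProd_eq_map_trajMeasure (X := fun _ => E)).symm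

/-- The Markov property, for a statistic `φ` of the past and the present `ψ (φ ·)`. -/
theorem chainLaw_markov (μ : Measure E) [IsProbabilityMeasure μ] (n : ℕ) {B : Type*}
    [MeasurableSpace B] {φ : (Finset.Iic n → E) → B} (hφ : Measurable φ) {ψ : B → E}
    (hψ : Measurable ψ) (h : ∀ p, ψ (φ p) = p ⟨n, Finset.mem_Iic.2 le_rfl⟩) :
    (chainLaw P μ).map (fun ω => (φ (frestrictLe (π := fun _ => E) n ω), ω (n + 1))) =
      (chainLaw P μ).map (fun ω => φ (frestrictLe n ω)) ⊗ₘ P.comap ψ hψ := by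
  have h1 : P.comap _ (measurable_last n) = (P.comap ψ hψ).comap φ hφ := by
    ext p : 1
    simp only [Kernel.comap_apply, h]
  have h2 := congrArg (Measure.map (Prod.map φ id)) (chainLaw_map_succ P μ n)
  rw [h1, map_compProd_comap, Measure.map_map (by fun_prop) (by fun_prop),
    Measure.map_map (by fun_prop) (by fun_prop)] at h2
  exact h2

theorem chainLaw_map_pair (μ : Measure E) [IsProbabilityMeasure μ] (n : ℕ) :
    (chainLaw P μ).map (fun ω => (ω n, ω (n + 1))) =
      (chainLaw P μ).map (fun ω => ω n) ⊗ₘ P := by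
  have := chainLaw_markov P μ n (measurable_last n) measurable_id (fun _ => rfl)
  simpa using this

/-- Keeping `X₀` beside the present state allows conditioning on time `n` inside `E f(X₀) g(Xₙ₊₁)`.
-/
theorem chainLaw_map_triple (μ : Measure E) [IsProbabilityMeasure μ] (n : ℕ) :
    (chainLaw P μ).map (fun ω => ((ω 0, ω n), ω (n + 1))) =
      (chainLaw P μ).map (fun ω => (ω 0, ω n)) ⊗ₘ P.comap Prod.snd measurable_snd :=
  chainLaw_markov P μ n
    (φ := fun p => (p ⟨0, Finset.mem_Iic.2 n.zero_le⟩, p ⟨n, Finset.mem_Iic.2 le_rfl⟩))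
    (by fun_prop) measurable_snd (fun _ => rfl)

theorem eq_chainLaw (μ : Measure E) [IsProbabilityMeasure μ] (Q : Measure (ℕ → E))
    [IsProbabilityMeasure Q] (h0 : Q.map (fun ω => ω 0) = μ)
    (hs : ∀ n, Q.map (fun ω => (frestrictLe (π := fun _ => E) n ω, ω (n + 1))) =
      Q.map (frestrictLe n) ⊗ₘ P.comap _ (measurable_last n)) :
    Q = chainLaw P μ := by
  refine measure_ext_frestrictLe fun n => ?_
  induction n with
  | zero =>
    have h2 : frestrictLe (π := fun _ => E) 0 =
        (MeasurableEquiv.piUnique (fun _ : Finset.Iic 0 => E)).symm ∘ fun ω : ℕ → E => ω 0 := by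
      ext ω i
      have : i = ⟨0, Finset.mem_Iic.2 le_rfl⟩ := Subsingleton.elim _ _
      subst this
      rfl
    rw [h2, ← Measure.map_map (by fun_prop) (by fun_prop), h0,
      ← Measure.map_map (by fun_prop) (by fun_prop), chainLaw_map_zero]
  | succ n ih =>
    let e : (Finset.Iic n → E) × E → (Finset.Iic (n + 1) → E) :=
      fun p i => if hi : (i : ℕ) ≤ n then p.1 ⟨i, Finset.mem_Iic.2 hi⟩ else p.2
    have he : Measurable e := by
      refine measurable_pi_lambda _ fun i => ?_
      by_cases hi : (i : ℕ) ≤ n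
      · simp only [e, hi, dite_true]; fun_prop
      · simp only [e, hi, dite_false]; fun_prop
    have h2 : frestrictLe (π := fun _ => E) (n + 1) =
        e ∘ fun ω => (frestrictLe (π := fun _ => E) n ω, ω (n + 1)) := by
      ext ω ⟨i, hi⟩
      rcases Nat.of_le_succ (Finset.mem_Iic.1 hi) with hi | hi
      · simp [e, hi]
      · subst hi; simp [e]
    rw [h2, ← Measure.map_map he (by fun_prop), ← Measure.map_map he (by fun_prop), hs, ih,
      chainLaw_map_succ]

variable {P} {μ : Measure E} [IsProbabilityMeasure μ]

theorem chainLaw_map_one (hμ : Kernel.Invariant P μ) : (chainLaw P μ).map (fun ω => ω 1) = μ := by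
  have h := congrArg Measure.snd (chainLaw_map_pair P μ 0)
  rw [chainLaw_map_zero, Measure.snd_compProd, Measure.snd_map_prodMk (by fun_prop)] at h
  exact h.trans hμ

/-- The shifted sequence starts from `μ` by invariance and has the same one-step transitions; these
two facts determine the law (`eq_chainLaw`). -/
theorem chainLaw_map_shift (hμ : Kernel.Invariant P μ) :
    (chainLaw P μ).map (fun ω n => ω (n + 1)) = chainLaw P μ := by
  have hm : Measurable fun (ω : ℕ → E) (n : ℕ) => ω (n + 1) := by fun_prop
  have := Measure.isProbabilityMeasure_map (μ := chainLaw P μ) hm.aemeasurable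
  refine eq_chainLaw P μ _ ?_ fun n => ?_
  · rw [Measure.map_map (by fun_prop) hm]
    exact chainLaw_map_one hμ
  · rw [Measure.map_map (by fun_prop) hm, Measure.map_map (by fun_prop) hm]
    exact chainLaw_markov P μ (n + 1)
      (φ := fun p (i : Finset.Iic n) =>
        p ⟨i + 1, Finset.mem_Iic.2 (Nat.succ_le_succ (Finset.mem_Iic.1 i.2))⟩)
      (by fun_prop) (measurable_last n) (fun _ => rfl)

theorem isStrictlyStationary_chainLaw (hμ : Kernel.Invariant P μ) :
    IsStrictlyStationary (fun (n : ℕ) (ω : ℕ → E) => ω n) (chainLaw P μ) := by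
  intro k
  have hid : (chainLaw P μ).map (fun (ω : ℕ → E) n => ω n) = chainLaw P μ := Measure.map_id
  rw [hid]
  induction k with
  | zero => exact hid
  | succ k ih =>
    conv_rhs => rw [← ih, ← chainLaw_map_shift hμ]
    rw [Measure.map_map (by fun_prop) (by fun_prop)]
    congr 1

theorem chainLaw_map_eval (hμ : Kernel.Invariant P μ) (n : ℕ) :
    (chainLaw P μ).map (fun ω => ω n) = μ := by
  have h := congrArg (Measure.map fun ω : ℕ → E => ω 0) (isStrictlyStationary_chainLaw hμ n)
  rw [Measure.map_map (by fun_prop) (by fun_prop),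
    Measure.map_map (by fun_prop) (by fun_prop)] at h
  have h' := chainLaw_map_zero P μ
  simpa [Function.comp_def, h'] using h

end ChainFacts

/-! ### Contractions and isometries of Hilbert spaces -/

section Hilbert

variable {H K : Type*} [NormedAddCommGroup H] [InnerProductSpace ℝ H] [CompleteSpace H]
  [NormedAddCommGroup K] [InnerProductSpace ℝ K] [CompleteSpace K]

/-- Banach–Alaoglu, carried over by the Riesz isomorphism; an ultrafilter replaces the passage to
subsequences, so separability plays no role. -/
theorem exists_weak_limit (u : Ultrafilter ℕ) {v : ℕ → H} {C : ℝ} (hv : ∀ n, ‖v n‖ ≤ C) :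
    ∃ z : H, ∀ h, Tendsto (fun n => inner ℝ (v n) h) u (𝓝 (inner ℝ z h)) := by
  let w : ℕ → WeakDual ℝ H := fun n => StrongDual.toWeakDual (InnerProductSpace.toDual ℝ H (v n))
  have hc := WeakDual.isCompact_closedBall (𝕜 := ℝ) (0 : StrongDual ℝ H) C
  obtain ⟨l, -, hl⟩ := hc.ultrafilter_le_nhds (u.map w) (by
    refine le_principal_iff.2 (mem_map.2 (univ_mem' fun n => ?_))
    simp only [Set.mem_preimage, mem_closedBall_zero_iff]
    exact ((InnerProductSpace.toDual ℝ H).norm_map (v n)).trans_le (hv n))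
  refine ⟨(InnerProductSpace.toDual ℝ H).symm (WeakDual.toStrongDual l), fun h => ?_⟩
  rw [InnerProductSpace.toDual_symm_apply]
  exact ((WeakDual.eval_continuous h).tendsto l).comp hl

/-- Expand the square: the cross term is `-2‖A x‖²`, and `‖A* A x‖ ≤ ‖A x‖`. -/
theorem norm_adjoint_comp_sub_le {A : H →L[ℝ] K} (hA : ∀ x, ‖A x‖ ≤ ‖x‖) (x : H) :
    ‖A.adjoint (A x) - x‖ ^ 2 ≤ ‖x‖ ^ 2 - ‖A x‖ ^ 2 := by
  have h1 : ‖A.adjoint (A x)‖ ≤ ‖A x‖ := by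
    have h2 : ‖A‖ ≤ 1 := A.opNorm_le_bound zero_le_one (by simpa using hA)
    have h3 : ‖A.adjoint‖ ≤ 1 := by simpa using h2
    simpa using A.adjoint.le_of_opNorm_le h3 (A x)
  have h2 : inner ℝ (A.adjoint (A x)) x = ‖A x‖ ^ 2 := by
    rw [ContinuousLinearMap.adjoint_inner_left, real_inner_self_eq_norm_sq]
  rw [norm_sub_sq_real, h2]
  have := pow_le_pow_left₀ (norm_nonneg _) h1 2
  linarith

/-- Weak limit points of the orbit of a contraction `T` have orbits of constant norm. -/
theorem exists_weak_limit_isometric {T : H →L[ℝ] H} (hT : ∀ x, ‖T x‖ ≤ ‖x‖) {u : Ultrafilter ℕ}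
    (hu : ↑u ≤ (atTop : Filter ℕ)) (x : H) :
    ∃ z : H, (∀ h, Tendsto (fun n => inner ℝ ((T ^ n) x) h) u (𝓝 (inner ℝ z h))) ∧
      ∀ k, ‖(T ^ k) z‖ = ‖z‖ := by
  have hTk : ∀ (k : ℕ) y, ‖(T ^ k) y‖ ≤ ‖y‖ := by
    intro k y
    induction k with
    | zero => simp
    | succ k ih => rw [pow_succ']; exact (hT _).trans ih
  obtain ⟨z, hz⟩ := exists_weak_limit u (fun n => hTk n x)
  refine ⟨z, hz, fun k => ?_⟩
  have hanti : Antitone fun n => ‖(T ^ n) x‖ ^ 2 := by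
    refine antitone_nat_of_succ_le fun n => ?_
    refine pow_le_pow_left₀ (norm_nonneg _) ?_ 2
    rw [pow_succ' T]
    exact hT _
  have hlim := tendsto_atTop_ciInf hanti ⟨0, by rintro _ ⟨n, rfl⟩; positivity⟩
  set A := T ^ k with hA
  have hdiff : Tendsto (fun n => A.adjoint (A ((T ^ n) x)) - (T ^ n) x) atTop (𝓝 0) := by
    rw [tendsto_zero_iff_norm_tendsto_zero]
    have h0 : Tendsto (fun n => ‖(T ^ n) x‖ ^ 2 - ‖(T ^ (n + k)) x‖ ^ 2) atTop (𝓝 0) := by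
      simpa using hlim.sub (hlim.comp (tendsto_add_atTop_nat k))
    have h1 : Tendsto (fun n => ‖A.adjoint (A ((T ^ n) x)) - (T ^ n) x‖ ^ 2) atTop (𝓝 0) := by
      refine squeeze_zero (fun n => by positivity) (fun n => ?_) h0
      have := norm_adjoint_comp_sub_le (hTk k) ((T ^ n) x)
      rwa [add_comm n k, pow_add]
    simpa using h1.sqrt
  -- `A* A` is self-adjoint, hence weakly continuous, so the limit `hdiff` along the orbit passes to
  -- `z`.
  have hfix : A.adjoint (A z) = z := by
    refine ext_inner_right ℝ fun h => ?_
    have h1 : Tendsto (fun n => inner ℝ (A.adjoint (A ((T ^ n) x))) h) u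
        (𝓝 (inner ℝ (A.adjoint (A z)) h)) := by
      simpa only [ContinuousLinearMap.adjoint_inner_left, ContinuousLinearMap.adjoint_inner_right]
        using hz (A.adjoint (A h))
    have h2 : Tendsto (fun n => inner ℝ (A.adjoint (A ((T ^ n) x)) - (T ^ n) x) h) u (𝓝 0) := by
      simpa using (hdiff.mono_left hu).inner (tendsto_const_nhds (x := h))
    have h3 := h2.add (hz h)
    simp only [inner_sub_left, sub_add_cancel, zero_add] at h3
    exact tendsto_nhds_unique h1 h3
  have h4 : ‖A z‖ ^ 2 = ‖z‖ ^ 2 := by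
    rw [← real_inner_self_eq_norm_sq (A z), ← ContinuousLinearMap.adjoint_inner_left, hfix,
      real_inner_self_eq_norm_sq]
  exact (pow_left_inj₀ (norm_nonneg _) (norm_nonneg _) two_ne_zero).1 h4

/-- If the adjoint of an isometry `J` preserves the norm of `v`, then `v` is in the range
of `J`. -/
theorem isometry_adjoint_eq (J : H →ₗᵢ[ℝ] K) {v : K}
    (hv : ‖J.toContinuousLinearMap.adjoint v‖ = ‖v‖) :
    J (J.toContinuousLinearMap.adjoint v) = v := by
  set A := J.toContinuousLinearMap
  have h1 : inner ℝ (A (A.adjoint v)) v = ‖v‖ ^ 2 := by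
    rw [← ContinuousLinearMap.adjoint_inner_right, real_inner_self_eq_norm_sq, hv]
  have h2 : ‖A (A.adjoint v)‖ = ‖v‖ := (J.norm_map _).trans hv
  have h3 : ‖A (A.adjoint v) - v‖ ^ 2 = 0 := by
    rw [norm_sub_sq_real, h1, h2]; ring
  exact sub_eq_zero.1 (norm_eq_zero.1 (pow_eq_zero_iff two_ne_zero |>.1 h3))

end Hilbert

/-! ### The transition operator on `L²(μ)` -/

section TransitionOperator

variable {E : Type*} [MeasurableSpace E] {P : Kernel E E} [IsMarkovKernel P]
  {μ : Measure E} [IsProbabilityMeasure μ]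

theorem measurePreserving_eval_chainLaw (hμ : Kernel.Invariant P μ) (n : ℕ) :
    MeasurePreserving (fun ω : ℕ → E => ω n) (chainLaw P μ) μ :=
  ⟨measurable_pi_apply n, chainLaw_map_eval hμ n⟩

theorem integral_eval_chainLaw (hμ : Kernel.Invariant P μ) (n : ℕ) {h : E → ℝ}
    (hh : StronglyMeasurable h) : ∫ ω, h (ω n) ∂(chainLaw P μ) = ∫ x, h x ∂μ := by
  have h1 := integral_map (μ := chainLaw P μ) (measurable_pi_apply n).aemeasurable
    hh.aestronglyMeasurable
  rw [chainLaw_map_eval hμ] at h1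
  exact h1.symm

/-- The isometry `f ↦ f (Xₙ)`. -/
noncomputable def evalL2 (hμ : Kernel.Invariant P μ) (n : ℕ) : Lp ℝ 2 μ →ₗᵢ[ℝ] Lp ℝ 2 (chainLaw P μ) :=
  Lp.compMeasurePreservingₗᵢ ℝ (fun ω : ℕ → E => ω n) (measurePreserving_eval_chainLaw hμ n)

theorem coeFn_evalL2 (hμ : Kernel.Invariant P μ) (n : ℕ) (f : Lp ℝ 2 μ) :
    evalL2 hμ n f =ᵐ[chainLaw P μ] fun ω => f (ω n) :=
  Lp.coeFn_compMeasurePreserving f (measurePreserving_eval_chainLaw hμ n)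

theorem inner_evalL2 (hμ : Kernel.Invariant P μ) (m n : ℕ) (f g : Lp ℝ 2 μ) :
    inner ℝ (evalL2 hμ m f) (evalL2 hμ n g) = ∫ ω, f (ω m) * g (ω n) ∂(chainLaw P μ) := by
  rw [L2.inner_def]
  refine integral_congr_ae ?_
  filter_upwards [coeFn_evalL2 hμ m f, coeFn_evalL2 hμ n g] with ω h1 h2
  simp [h1, h2, mul_comm]

/-- The `L²` version of the transition operator `f ↦ ∫ f(y) P(·, dy)`. -/
noncomputable def transL2 (hμ : Kernel.Invariant P μ) : Lp ℝ 2 μ →L[ℝ] Lp ℝ 2 μ :=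
  (evalL2 hμ 0).toContinuousLinearMap.adjoint ∘L (evalL2 hμ 1).toContinuousLinearMap

theorem inner_transL2 (hμ : Kernel.Invariant P μ) (f g : Lp ℝ 2 μ) :
    inner ℝ f (transL2 hμ g) = inner ℝ (evalL2 hμ 0 f) (evalL2 hμ 1 g) := by
  rw [transL2, ContinuousLinearMap.comp_apply, ContinuousLinearMap.adjoint_inner_right]
  rfl

theorem norm_transL2_le (hμ : Kernel.Invariant P μ) (g : Lp ℝ 2 μ) : ‖transL2 hμ g‖ ≤ ‖g‖ := by
  have h : ‖transL2 hμ g‖ * ‖transL2 hμ g‖ ≤ ‖transL2 hμ g‖ * ‖g‖ := by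
    rw [← real_inner_self_eq_norm_mul_norm, inner_transL2]
    exact (real_inner_le_norm _ _).trans_eq (by rw [LinearIsometry.norm_map,
      LinearIsometry.norm_map])
  rcases (norm_nonneg (transL2 hμ g)).eq_or_lt with h0 | h0
  · rw [← h0]; exact norm_nonneg _
  · exact le_of_mul_le_mul_left h h0

theorem integrable_mul_eval (hμ : Kernel.Invariant P μ) (m n : ℕ) (f g : Lp ℝ 2 μ) :
    Integrable (fun ω : ℕ → E => f (ω m) * g (ω n)) (chainLaw P μ) :=
  ((Lp.memLp f).comp_measurePreserving (measurePreserving_eval_chainLaw hμ m)).integrable_mul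
    ((Lp.memLp g).comp_measurePreserving (measurePreserving_eval_chainLaw hμ n))

theorem integral_mul_eval_succ (hμ : Kernel.Invariant P μ) (n : ℕ) (f g : Lp ℝ 2 μ) :
    ∫ ω, f (ω 0) * g (ω (n + 1)) ∂(chainLaw P μ) =
      ∫ ω, f (ω 0) * ∫ y, g y ∂(P (ω n)) ∂(chainLaw P μ) := by
  have hF : StronglyMeasurable fun p : (E × E) × E => f p.1.1 * g p.2 :=
    ((Lp.stronglyMeasurable f).comp_measurable (by fun_prop)).mul
      ((Lp.stronglyMeasurable g).comp_measurable (by fun_prop))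
  have hm : AEMeasurable (fun ω : ℕ → E => ((ω 0, ω n), ω (n + 1))) (chainLaw P μ) := by
    fun_prop
  have h1 : ∫ ω, f (ω 0) * g (ω (n + 1)) ∂(chainLaw P μ) =
      ∫ p, f p.1.1 * g p.2 ∂((chainLaw P μ).map fun ω => ((ω 0, ω n), ω (n + 1))) :=
    (integral_map hm hF.aestronglyMeasurable).symm
  have hint : Integrable (fun p : (E × E) × E => f p.1.1 * g p.2)
      ((chainLaw P μ).map fun ω => ((ω 0, ω n), ω (n + 1))) :=
    (integrable_map_measure hF.aestronglyMeasurable hm).2 (integrable_mul_eval hμ 0 (n + 1) f g)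
  rw [chainLaw_map_triple] at h1 hint
  rw [h1, Measure.integral_compProd hint, integral_map (by fun_prop)]
  · simp only [integral_const_mul, Kernel.comap_apply]
  · exact (hF.integral_kernel_prod_right' (κ := P.comap Prod.snd measurable_snd)).aestronglyMeasurable

/-- Both sides have the same integral over each measurable set: pair the operator with an indicator
and condition on `X₀`. -/
theorem coeFn_transL2 (hμ : Kernel.Invariant P μ) (g : Lp ℝ 2 μ) : transL2 hμ g =ᵐ[μ] fun x => ∫ y, g y ∂(P x) := by
  have hg : StronglyMeasurable fun x => ∫ y, g y ∂(P x) :=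
    (Lp.stronglyMeasurable g).integral_kernel
  have hgi : Integrable (fun x => ∫ y, g y ∂(P x)) μ := by
    have h : Integrable g (P ∘ₘ μ) := by
      rw [hμ.def]; exact (Lp.memLp g).integrable (by norm_num)
    exact (Measure.integrable_integral_norm_of_integrable_comp h).mono' hg.aestronglyMeasurable
      (ae_of_all _ fun x => norm_integral_le_integral_norm _)
  refine Integrable.ae_eq_of_forall_setIntegral_eq _ _
    ((Lp.memLp _).integrable (by norm_num)) hgi fun s hs _ => ?_
  have h1 := inner_transL2 hμ (indicatorConstLp 2 hs (measure_ne_top μ s) (1 : ℝ)) g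
  rw [L2.inner_indicatorConstLp_one, inner_evalL2, integral_mul_eval_succ hμ] at h1
  rw [h1, ← integral_indicator hs]
  have h2 : ∀ᵐ ω ∂(chainLaw P μ), indicatorConstLp 2 hs (measure_ne_top μ s) (1 : ℝ) (ω 0) =
      s.indicator (fun _ => (1 : ℝ)) (ω 0) :=
    (measurePreserving_eval_chainLaw hμ 0).quasiMeasurePreserving.ae indicatorConstLp_coeFn
  have h3 : ∫ x, s.indicator (fun x => ∫ y, g y ∂(P x)) x ∂μ =
      ∫ ω, s.indicator (fun x => ∫ y, g y ∂(P x)) (ω 0) ∂(chainLaw P μ) :=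
    (integral_eval_chainLaw hμ 0 (hg.indicator hs)).symm
  rw [h3]
  refine integral_congr_ae ?_
  filter_upwards [h2] with ω h
  rw [h]
  by_cases hω : ω 0 ∈ s <;> simp [hω]

/-- The adjoint of `f ↦ f(X₀)` acts as conditional expectation given `X₀`. In the induction,
conditioning at time `n` replaces `g(Xₙ₊₁)` by `(T g)(Xₙ)`. -/
theorem adjoint_evalL2_eq (hμ : Kernel.Invariant P μ) (n : ℕ) (g : Lp ℝ 2 μ) :
    (evalL2 hμ 0).toContinuousLinearMap.adjoint (evalL2 hμ n g) = (transL2 hμ ^ n) g := by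
  induction n generalizing g with
  | zero =>
    refine ext_inner_left ℝ fun f => ?_
    rw [ContinuousLinearMap.adjoint_inner_right]
    exact (evalL2 hμ 0).inner_map_map f g
  | succ n ih =>
    rw [pow_succ, mul_apply_eq_comp, ← ih]
    refine ext_inner_left ℝ fun f => ?_
    rw [ContinuousLinearMap.adjoint_inner_right, ContinuousLinearMap.adjoint_inner_right]
    change inner ℝ (evalL2 hμ 0 f) _ = inner ℝ (evalL2 hμ 0 f) _
    rw [inner_evalL2, inner_evalL2, integral_mul_eval_succ hμ]
    refine integral_congr_ae ?_
    filter_upwards [(measurePreserving_eval_chainLaw hμ n).quasiMeasurePreserving.ae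
      (coeFn_transL2 hμ g)] with ω h
    rw [h]

theorem inner_transL2_pow (hμ : Kernel.Invariant P μ) (n : ℕ) (f g : Lp ℝ 2 μ) :
    inner ℝ f ((transL2 hμ ^ n) g) = ∫ ω, f (ω 0) * g (ω n) ∂(chainLaw P μ) := by
  rw [← adjoint_evalL2_eq, ContinuousLinearMap.adjoint_inner_right, ← inner_evalL2 hμ]
  rfl

/-- If the transition operator preserves the norm of `z`, then `z (Xₙ)` is a function of `X₀`. -/
theorem eval_ae_eq_of_norm_eq (hμ : Kernel.Invariant P μ) {z : Lp ℝ 2 μ} {n : ℕ} (h : ‖(transL2 hμ ^ n) z‖ = ‖z‖) :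
    ∀ᵐ ω ∂(chainLaw P μ), z (ω n) = (transL2 hμ ^ n) z (ω 0) := by
  have h1 := isometry_adjoint_eq (evalL2 hμ 0) (v := evalL2 hμ n z)
    (by rw [adjoint_evalL2_eq, h, LinearIsometry.norm_map])
  rw [adjoint_evalL2_eq] at h1
  have h2 := coeFn_evalL2 hμ 0 ((transL2 hμ ^ n) z)
  rw [h1] at h2
  filter_upwards [h2, coeFn_evalL2 hμ n z] with ω h3 h4
  rw [← h4, h3]

end TransitionOperator

/-! ### Uniform absolute continuity of the marginals -/

section UniformAbsoluteContinuity

theorem exists_uniform_of_absolutelyContinuous {S : Type*} [MeasurableSpace S] {μ ν : Measure S}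
    [IsFiniteMeasure μ] [IsFiniteMeasure ν] (h : ν ≪ μ) {b : ℝ≥0∞} (hb : 0 < b) :
    ∃ c > 0, ∀ A, MeasurableSet A → μ A ≤ c → ν A ≤ b := by
  obtain ⟨c, hc, hcA⟩ := exists_pos_setLIntegral_lt_of_measure_lt (μ := μ) (f := ν.rnDeriv μ)
    (Measure.lintegral_rnDeriv_lt_top ν μ).ne hb.ne'
  obtain ⟨c', hc', hcc'⟩ := exists_between hc
  refine ⟨c', hc', fun A _ hA => ?_⟩
  rw [← Measure.setLIntegral_rnDeriv h]
  exact (hcA A (hA.trans_lt hcc')).le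

/-- By Hölder, `ν A ≤ R · μ(A)^(1/q)`, which dictates `c = (b / R)^q`. This `c` serves all pairs of
measures at once, as needed when the coupling varies with `n` and `ε`. -/
theorem exists_uniform_of_rnDeriv_Lp {S : Type*} [MeasurableSpace S] {p R : ℝ} (hp : 1 < p)
    (hR : 1 ≤ R) {b : ℝ≥0∞} (hb : 0 < b) (hb' : b ≠ ∞) :
    ∃ c > 0, ∀ μ ν : Measure S, IsFiniteMeasure μ → IsFiniteMeasure ν → ν ≪ μ →
      (∫⁻ s, ν.rnDeriv μ s ^ p ∂μ) ^ (1 / p) ≤ ENNReal.ofReal R →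
      ∀ A, MeasurableSet A → μ A ≤ c → ν A ≤ b := by
  have hq := Real.HolderConjugate.conjExponent hp
  set q := p.conjExponent
  have hR0 : ENNReal.ofReal R ≠ 0 := by
    simpa using zero_lt_one.trans_le hR
  refine ⟨(b / ENNReal.ofReal R) ^ q, ENNReal.rpow_pos (ENNReal.div_pos hb.ne' ENNReal.ofReal_ne_top)
    (ENNReal.div_ne_top hb' hR0), fun μ ν _ _ h hν A hA hμA => ?_⟩
  rw [← Measure.setLIntegral_rnDeriv h, ← lintegral_indicator hA]
  calc ∫⁻ s, A.indicator (ν.rnDeriv μ) s ∂μ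
      = ∫⁻ s, (ν.rnDeriv μ * A.indicator (1 : S → ℝ≥0∞)) s ∂μ := by
        refine lintegral_congr fun s => ?_
        by_cases hs : s ∈ A <;> simp [hs]
    _ ≤ (∫⁻ s, ν.rnDeriv μ s ^ p ∂μ) ^ (1 / p) * (∫⁻ s, A.indicator (1 : S → ℝ≥0∞) s ^ q ∂μ) ^ (1 / q) :=
        ENNReal.lintegral_mul_le_Lp_mul_Lq μ hq (Measure.measurable_rnDeriv ν μ).aemeasurable
          (measurable_one.indicator hA).aemeasurable
    _ ≤ ENNReal.ofReal R * (b / ENNReal.ofReal R) := by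
        have h1 : ∫⁻ s, A.indicator (1 : S → ℝ≥0∞) s ^ q ∂μ = μ A := by
          rw [← lintegral_indicator_one hA]
          refine lintegral_congr fun s => ?_
          by_cases hs : s ∈ A <;> simp [hs, hq.symm.pos]
        rw [h1]
        gcongr
        calc μ A ^ (1 / q) ≤ ((b / ENNReal.ofReal R) ^ q) ^ (1 / q) :=
              ENNReal.rpow_le_rpow hμA (by have := hq.symm.pos; positivity)
          _ = b / ENNReal.ofReal R := by
              rw [← ENNReal.rpow_mul, mul_one_div_cancel hq.symm.pos.ne', ENNReal.rpow_one]
    _ = b := ENNReal.mul_div_cancel hR0 ENNReal.ofReal_ne_top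

end UniformAbsoluteContinuity

/-! ### A common consequence of the three coupling conditions -/

section CouplingConditions

variable {E : Type*} [MeasurableSpace E] (d : E → E → ℝ) (P : Kernel E E) [IsMarkovKernel P]

/-- Some generalized coupling charges `d (Xₙ, Yₙ) ≤ ε` with more than twice the mass that its
marginals give to any event of probability at most `c` under the laws of the chain. -/
def CloseAtTime (c : ℝ≥0∞) (ε : ℝ) (n : ℕ) (x y : E) : Prop :=
  ∃ ξ ∈ genCouplings (chainLawFrom P x) (chainLawFrom P y), ∃ b : ℝ≥0∞,
    2 * b < ξ (closeAt d n ε) ∧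
    (∀ A, MeasurableSet A → chainLawFrom P x A ≤ c → ξ.fst A ≤ b) ∧
    (∀ A, MeasurableSet A → chainLawFrom P y A ≤ c → ξ.snd A ≤ b)

/-- `CloseAtTime` holds at all late times, at a level `c` which does not depend on `ε`. -/
def EventuallyClose (c : ℝ≥0∞) (x y : E) : Prop :=
  ∀ ε > 0, ∀ᶠ n in atTop, CloseAtTime d P c ε n x y

variable {d P}

theorem CloseAtTime.mono {c c' : ℝ≥0∞} (hc : c' ≤ c) {ε : ℝ} {n : ℕ} {x y : E}
    (h : CloseAtTime d P c ε n x y) : CloseAtTime d P c' ε n x y := by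
  obtain ⟨ξ, hξ, b, hb, h1, h2⟩ := h
  exact ⟨ξ, hξ, b, hb, fun A hA hAc => h1 A hA (hAc.trans hc),
    fun A hA hAc => h2 A hA (hAc.trans hc)⟩

theorem EventuallyClose.mono {c c' : ℝ≥0∞} (hc : c' ≤ c) {x y : E}
    (h : EventuallyClose d P c x y) : EventuallyClose d P c' x y :=
  fun ε hε => (h ε hε).mono fun _ hn => hn.mono hc

/-- Pick `q` strictly between `0` and the limit and take `b = q / 2`, so that `2 * b = q`.
Uniformity over `C` gives `c` from `b` alone, before `ε` is chosen. -/
theorem exists_eventuallyClose {x y : E} {C : Set (Measure ((ℕ → E) × (ℕ → E)))}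
    (hC : C ⊆ genCouplings (chainLawFrom P x) (chainLawFrom P y))
    (hunif : ∀ b : ℝ≥0∞, 0 < b → b ≠ ∞ → ∃ c > 0, ∀ ξ ∈ C, ∀ A, MeasurableSet A →
      (chainLawFrom P x A ≤ c → ξ.fst A ≤ b) ∧ (chainLawFrom P y A ≤ c → ξ.snd A ≤ b))
    (h : HasPosLimitAtZero fun ε => liminf (fun n => ⨆ ξ ∈ C, ξ (closeAt d n ε)) atTop) :
    ∃ c > 0, EventuallyClose d P c x y := by
  obtain ⟨l, hl, hlim⟩ := h
  obtain ⟨q, hq, hql⟩ := exists_between hl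
  obtain ⟨c, hc, hcC⟩ := hunif (q / 2) (ENNReal.half_pos hq.ne')
    (ENNReal.div_ne_top hql.ne_top two_ne_zero)
  refine ⟨c, hc, fun ε hε => ?_⟩
  -- Any `ε' ≤ ε` will do, since the event grows with `ε`.
  obtain ⟨ε', h1, h2⟩ := ((hlim.eventually_const_lt hql).and (Ioc_mem_nhdsGT hε)).exists
  filter_upwards [eventually_lt_of_lt_liminf h1] with n hn
  obtain ⟨ξ, hξ⟩ := lt_iSup_iff.1 hn
  obtain ⟨hξC, hξ⟩ := lt_iSup_iff.1 hξ
  refine ⟨ξ, hC hξC, q / 2, ?_, fun A hA => (hcC ξ hξC A hA).1, fun A hA => (hcC ξ hξC A hA).2⟩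
  rw [ENNReal.mul_div_cancel two_ne_zero ENNReal.ofNat_ne_top]
  exact hξ.trans_le (measure_mono fun ω hω => le_trans hω h2.2)

theorem CouplingCond.exists_eventuallyClose {x y : E} (h : CouplingCond d P x y) :
    ∃ c > 0, EventuallyClose d P c x y := by
  refine GenCoupling.exists_eventuallyClose
    (C := couplings (chainLawFrom P x) (chainLawFrom P y)) ?_ ?_ h
  · rintro ξ ⟨h0, h1, h2⟩
    exact ⟨h0, h1 ▸ Measure.AbsolutelyContinuous.rfl, h2 ▸ Measure.AbsolutelyContinuous.rfl⟩
  · intro b hb _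
    refine ⟨b, hb, ?_⟩
    rintro ξ ⟨_, h1, h2⟩ A _
    rw [h1, h2]
    exact ⟨id, id⟩

theorem GenCouplingLpCond.exists_eventuallyClose {x y : E} (h : GenCouplingLpCond d P x y) :
    ∃ c > 0, EventuallyClose d P c x y := by
  obtain ⟨p, R, hp, hR, h⟩ := h
  refine GenCoupling.exists_eventuallyClose (fun ξ hξ => hξ.1) (fun b hb hb' => ?_) h
  obtain ⟨c, hc, H⟩ := exists_uniform_of_rnDeriv_Lp (S := ℕ → E) hp hR hb hb'
  refine ⟨c, hc, ?_⟩
  rintro ξ ⟨⟨_, h1, h2⟩, h3, h4⟩ A hA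
  exact ⟨H _ _ inferInstance inferInstance h1 h3 A hA, H _ _ inferInstance inferInstance h2 h4 A hA⟩

theorem GenCouplingCond.exists_eventuallyClose {x y : E} (h : GenCouplingCond d P x y) :
    ∃ c > 0, EventuallyClose d P c x y := by
  obtain ⟨ξ, hξ, h⟩ := h
  refine GenCoupling.exists_eventuallyClose (C := {ξ}) (by simpa using hξ) (fun b hb _ => ?_)
    (by simpa using h)
  obtain ⟨_, h1, h2⟩ := hξ
  obtain ⟨c, hc, H⟩ := exists_uniform_of_absolutelyContinuous h1 hb
  obtain ⟨c', hc', H'⟩ := exists_uniform_of_absolutelyContinuous h2 hb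
  refine ⟨min c c', lt_min hc hc', ?_⟩
  rintro _ rfl A hA
  exact ⟨fun h => H A hA (h.trans (min_le_left _ _)), fun h => H' A hA (h.trans (min_le_right _ _))⟩

end CouplingConditions

/-! ### Almost uniform continuity with respect to `d` -/

section AlmostContinuity

theorem IsMetric.nonneg {E : Type*} {d : E → E → ℝ} (hd : IsMetric d) (x y : E) : 0 ≤ d x y := by
  have h1 := hd.triangle x y x
  rw [hd.self, hd.symm y x] at h1
  linarith

/-- A continuous function is uniformly continuous on compact sets, with respect to any continuous
metric. -/
theorem IsMetric.exists_modulus {E : Type*} [TopologicalSpace E] {d : E → E → ℝ} (hd : IsMetric d)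
    (hdc : Continuous fun p : E × E => d p.1 p.2) {w : E → ℝ} (hw : Continuous w) {K : Set E}
    (hK : IsCompact K) {δ : ℝ} (hδ : 0 < δ) :
    ∃ ε > 0, ∀ u ∈ K, ∀ v ∈ K, d u v ≤ ε → |w u - w v| < δ := by
  -- The pairs in `K` that violate the modulus form a compact set off the diagonal, where `d` has a
  -- positive minimum.
  set S : Set (E × E) := (K ×ˢ K) ∩ {p | δ ≤ |w p.1 - w p.2|}
  have hS : IsCompact S :=
    (hK.prod hK).inter_right (isClosed_le continuous_const (by fun_prop))
  rcases S.eq_empty_or_nonempty with h0 | h0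
  · refine ⟨1, one_pos, fun u hu v hv _ => not_le.1 fun h => ?_⟩
    have : (u, v) ∈ S := ⟨⟨hu, hv⟩, h⟩
    simp [h0] at this
  · obtain ⟨p, hp, hmin⟩ := hS.exists_isMinOn h0 hdc.continuousOn
    have hpos : 0 < d p.1 p.2 := by
      refine lt_of_le_of_ne (hd.nonneg _ _) fun h => ?_
      have h1 : δ ≤ |w p.1 - w p.2| := hp.2
      rw [hd.eq_of _ _ h.symm] at h1
      simp at h1
      linarith
    refine ⟨d p.1 p.2 / 2, by positivity, fun u hu v hv huv => not_le.1 fun h => ?_⟩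
    have h1 : d p.1 p.2 ≤ d u v := hmin (show (u, v) ∈ S from ⟨⟨hu, hv⟩, h⟩)
    linarith

/-- A form of Lusin's theorem: an integrable function is, up to `δ`, uniformly continuous with
respect to `d` off a set of small measure. -/
theorem IsMetric.exists_almost_modulus {E : Type*} [MetricSpace E] [CompleteSpace E]
    [TopologicalSpace.SeparableSpace E] [MeasurableSpace E] [BorelSpace E] {d : E → E → ℝ}
    (hd : IsMetric d) (hdc : Continuous fun p : E × E => d p.1 p.2) (μ : Measure E)
    [IsFiniteMeasure μ] {z : E → ℝ} (hzm : Measurable z) (hz : Integrable z μ) {δ : ℝ} (hδ : 0 < δ)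
    {η : ℝ≥0∞} (hη : η ≠ 0) :
    ∃ G, MeasurableSet G ∧ μ Gᶜ ≤ η ∧ ∃ ε > 0, ∀ u ∈ G, ∀ v ∈ G, d u v ≤ ε → |z u - z v| ≤ δ := by
  have := UniformSpace.secondCountable_of_separable E
  have hδ3 : ENNReal.ofReal (δ / 3) ≠ 0 := by simpa using by positivity
  -- The `L¹` error is a product so that Chebyshev at level `δ / 3` leaves an exceptional set of
  -- mass at most `η / 2`; the other half of `η` is spent on the complement of a compact set.
  obtain ⟨w, hw, -⟩ := hz.exists_boundedContinuous_lintegral_sub_le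
    (ε := ENNReal.ofReal (δ / 3) * (η / 2)) (by simp [hη, hδ])
  obtain ⟨K, hK, hKη⟩ := isTightMeasureSet_iff_exists_isCompact_measure_compl_le.1
    (isTightMeasureSet_singleton (μ := μ)) (η / 2) (ENNReal.half_pos hη)
  obtain ⟨ε, hε, hεK⟩ := hd.exists_modulus hdc w.continuous hK (δ := δ / 3) (by positivity)
  have hme : Measurable fun x => ‖z x - w x‖ₑ := (hzm.sub w.continuous.measurable).enorm
  set B : Set E := {x | ENNReal.ofReal (δ / 3) ≤ ‖z x - w x‖ₑ}
  have hBm : MeasurableSet B := measurableSet_le measurable_const hme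
  have hB : μ B ≤ η / 2 := by
    have h1 := (mul_meas_ge_le_lintegral (μ := μ) hme (ENNReal.ofReal (δ / 3))).trans hw
    exact (ENNReal.mul_le_mul_iff_right hδ3 ENNReal.ofReal_ne_top).1 h1
  refine ⟨K ∩ Bᶜ, hK.measurableSet.inter hBm.compl, ?_, ε, hε, fun u hu v hv huv => ?_⟩
  · rw [Set.compl_inter, compl_compl]
    exact (measure_union_le _ _).trans ((add_le_add (hKη μ rfl) hB).trans_eq (ENNReal.add_halves η))
  · have key : ∀ x ∈ Bᶜ, |z x - w x| ≤ δ / 3 := by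
      intro x hx
      have h1 : ‖z x - w x‖ₑ < ENNReal.ofReal (δ / 3) := not_le.1 hx
      rw [← ofReal_norm, ENNReal.ofReal_lt_ofReal_iff (by positivity)] at h1
      exact h1.le
    have h1 := abs_le.1 (key u hu.2)
    have h2 := abs_le.1 (key v hv.2)
    have h3 := abs_lt.1 (hεK u hu.1 v hv.1 huv)
    exact abs_le.2 ⟨by linarith, by linarith⟩

end AlmostContinuity

/-! ### From couplings to nearly equal values -/

section Constancy

variable {E : Type*} [MeasurableSpace E] {P : Kernel E E} [IsMarkovKernel P]
  {μ : Measure E} [IsProbabilityMeasure μ]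

/-- The coupling gives mass at most `2 * b` to `Xₙ ∉ G` or `Yₙ ∉ G`, and absolute continuity of its
marginals preserves the almost sure identities. The closeness event has larger mass, so some pair of
trajectories is close, lies in `G` at time `n`, and has the values `w x`, `w y`. -/
theorem CloseAtTime.abs_sub_le {d : E → E → ℝ} {c : ℝ≥0∞} {ε δ : ℝ} {n : ℕ} {x y : E}
    (h : CloseAtTime d P c ε n x y) {z w : E → ℝ} {G : Set E} (hG : MeasurableSet G)
    (hGε : ∀ u ∈ G, ∀ v ∈ G, d u v ≤ ε → |z u - z v| ≤ δ)
    (hx : ∀ᵐ ω ∂(chainLawFrom P x), z (ω n) = w x) (hy : ∀ᵐ ω ∂(chainLawFrom P y), z (ω n) = w y)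
    (hxG : chainLawFrom P x {ω | ω n ∈ Gᶜ} ≤ c) (hyG : chainLawFrom P y {ω | ω n ∈ Gᶜ} ≤ c) :
    |w x - w y| ≤ δ := by
  obtain ⟨ξ, ⟨_, hξx, hξy⟩, b, hb, h1, h2⟩ := h
  have hGm : MeasurableSet {ω : ℕ → E | ω n ∈ Gᶜ} := measurable_pi_apply n hG.compl
  have e1 : ξ {p | p.1 n ∈ Gᶜ} ≤ b := by
    have := h1 _ hGm hxG
    rwa [Measure.fst_apply hGm] at this
  have e2 : ξ {p | p.2 n ∈ Gᶜ} ≤ b := by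
    have := h2 _ hGm hyG
    rwa [Measure.snd_apply hGm] at this
  have e3 : ξ {p | ¬ z (p.1 n) = w x} = 0 :=
    ae_of_ae_map measurable_fst.aemeasurable (hξx.ae_le hx)
  have e4 : ξ {p | ¬ z (p.2 n) = w y} = 0 :=
    ae_of_ae_map measurable_snd.aemeasurable (hξy.ae_le hy)
  by_contra hcon
  have hsub : closeAt d n ε ⊆ ({p | p.1 n ∈ Gᶜ} ∪ {p | p.2 n ∈ Gᶜ}) ∪
      ({p | ¬ z (p.1 n) = w x} ∪ {p | ¬ z (p.2 n) = w y}) := by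
    intro p hp
    by_contra hpU
    simp only [Set.mem_union, Set.mem_ofPred_eq, Set.mem_compl_iff, not_or, not_not] at hpU
    obtain ⟨⟨h3, h4⟩, h5, h6⟩ := hpU
    exact hcon (h5 ▸ h6 ▸ hGε _ h3 _ h4 hp)
  have hle : ξ (closeAt d n ε) ≤ (b + b) + (0 + 0) :=
    (measure_mono hsub).trans ((measure_union_le _ _).trans (add_le_add
      ((measure_union_le _ _).trans (add_le_add e1 e2))
      ((measure_union_le _ _).trans (add_le_add e3.le e4.le))))
  rw [add_zero, add_zero, ← two_mul] at hle
  exact absurd hb (not_lt.2 hle)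

theorem ae_chainLawFrom_eval [MeasurableSingletonClass E] {z w : E → ℝ} {n : ℕ}
    (h : ∀ᵐ ω ∂(chainLaw P μ), z (ω n) = w (ω 0)) :
    ∀ᵐ x ∂μ, ∀ᵐ ω ∂(chainLawFrom P x), z (ω n) = w x := by
  rw [chainLaw_eq_comp] at h
  filter_upwards [Measure.ae_ae_of_ae_comp h] with x hx
  rw [← chainLawFrom_eq] at hx
  filter_upwards [hx, ae_chainLawFrom_zero P x] with ω h1 h2
  rw [h1, h2]

/-- Markov's inequality: by invariance, `P_x(Xₙ ∈ A)` integrates to `μ A`. -/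
theorem measure_lt_chainLawFrom_le (hμ : Kernel.Invariant P μ) {c η : ℝ≥0∞} (hc : c ≠ 0)
    (hc' : c ≠ ∞) (n : ℕ) {A : Set E} (hA : MeasurableSet A) (hAη : μ A ≤ c * η) :
    μ {x | c < chainLawFrom P x {ω | ω n ∈ A}} ≤ η := by
  have hAm : MeasurableSet {ω : ℕ → E | ω n ∈ A} := measurable_pi_apply n hA
  have h1 : ∫⁻ x, chainKernel P x {ω | ω n ∈ A} ∂μ = μ A := by
    rw [← Measure.bind_apply hAm (by fun_prop), ← chainLaw_eq_comp]
    exact (measurePreserving_eval_chainLaw hμ n).measure_preimage hA.nullMeasurableSet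
  have h2 := mul_meas_ge_le_lintegral (μ := μ) (Kernel.measurable_coe (chainKernel P) hAm) c
  rw [h1] at h2
  refine (measure_mono fun x hx => ?_).trans
    ((ENNReal.mul_le_mul_iff_right hc hc').1 (h2.trans hAη))
  simp only [Set.mem_ofPred_eq, chainLawFrom_eq] at hx ⊢
  exact hx.le

/-- Continuity from below holds for arbitrary increasing sets. The sets of pairs defined through the
existence of couplings can thus be used without proving them measurable. -/
theorem exists_lt_measure_of_subset_iUnion {S : Type*} [MeasurableSpace S] {ν : Measure S}
    {A : ℕ → Set S} (hA : Monotone A) {a : ℝ≥0∞} {B : Set S} (ha : a < ν B) (hB : B ⊆ ⋃ n, A n) :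
    ∃ n, a < ν (A n) := by
  have h := ha.trans_le (measure_mono hB)
  rw [hA.measure_iUnion] at h
  exact lt_iSup_iff.1 h

/-- Stationarity gives `z` and `w` the same law under `μ`, because `z(Xₙ) = w(X₀)` almost surely; so
the differences at two independent points agree in law. -/
theorem prod_measure_abs_sub_eq (hμ : Kernel.Invariant P μ) {z w : E → ℝ} (hz : Measurable z)
    (hw : Measurable w) {n : ℕ} (h : ∀ᵐ ω ∂(chainLaw P μ), z (ω n) = w (ω 0)) (δ : ℝ) :
    (μ.prod μ) {p | δ < |w p.1 - w p.2|} = (μ.prod μ) {p | δ < |z p.1 - z p.2|} := by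
  have hlaw : μ.map w = μ.map z := by
    have h0 := (measurePreserving_eval_chainLaw hμ 0).map_eq
    have hn := (measurePreserving_eval_chainLaw hμ n).map_eq
    have h1 : (chainLaw P μ).map (fun ω => z (ω n)) = (chainLaw P μ).map (fun ω => w (ω 0)) :=
      Measure.map_congr h
    have h2 := Measure.map_map (μ := chainLaw P μ) hz (measurable_pi_apply (X := fun _ => E) n)
    have h3 := Measure.map_map (μ := chainLaw P μ) hw (measurable_pi_apply (X := fun _ => E) 0)
    rw [hn] at h2
    rw [h0] at h3
    exact h3.trans (h1.symm.trans h2.symm)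
  have hm : MeasurableSet {p : ℝ × ℝ | δ < |p.1 - p.2|} :=
    measurableSet_lt measurable_const (by fun_prop)
  have h1 := Measure.map_prod_map μ μ hw hw
  have h2 := Measure.map_prod_map μ μ hz hz
  rw [hlaw, h2] at h1
  have h3 := congrArg (fun ν => ν {p : ℝ × ℝ | δ < |p.1 - p.2|}) h1
  have h4 : ∀ {φ : E → ℝ}, Measurable φ →
      ((μ.prod μ).map (Prod.map φ φ)) {p : ℝ × ℝ | δ < |p.1 - p.2|} =
        (μ.prod μ) {p | δ < |φ p.1 - φ p.2|} :=
    fun hφ => Measure.map_apply (by fun_prop) hm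
  rw [← h4 hw, ← h4 hz]
  exact h3.symm

end Constancy

/-! ### Weak limits are constant, and mixing -/

section Main

variable {E : Type*} [MetricSpace E] [CompleteSpace E] [TopologicalSpace.SeparableSpace E]
  [MeasurableSpace E] [BorelSpace E] {d : E → E → ℝ} {P : Kernel E E} [IsMarkovKernel P]
  {μ : Measure E} [IsProbabilityMeasure μ]

theorem prod_measure_lt_abs_sub_le (hd : IsMetric d) (hdc : Continuous fun p : E × E => d p.1 p.2)
    (hμ : Kernel.Invariant P μ) {M : Set (E × E)} (hM : (μ.prod μ) M = 1)
    (hclose : ∀ x y, (x, y) ∈ M → ∃ c > 0, EventuallyClose d P c x y)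
    {z : E → ℝ} {w : ℕ → E → ℝ} (hz : Measurable z) (hzi : Integrable z μ)
    (hw : ∀ n, Measurable (w n)) (h : ∀ n, ∀ᵐ ω ∂(chainLaw P μ), z (ω n) = w n (ω 0))
    {δ : ℝ} (hδ : 0 < δ) {η : ℝ≥0∞} (hη : η ≠ 0) :
    (μ.prod μ) {p | δ < |z p.1 - z p.2|} ≤ 3 * η := by
  have h1η : 1 - η < (μ.prod μ) M := by
    rw [hM]; exact ENNReal.sub_lt_self ENNReal.one_ne_top one_ne_zero hη
  -- The level depends on the pair, but one level `c` serves all pairs outside mass `η`. The order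
  -- of choices matters: `c`, then `G` and `ε` with `μ Gᶜ ≤ c * η`, then a time `n` good for most
  -- pairs.
  obtain ⟨j, hj⟩ := exists_lt_measure_of_subset_iUnion
    (A := fun j : ℕ => {p : E × E | EventuallyClose d P ((j : ℝ≥0∞) + 1)⁻¹ p.1 p.2})
    (fun i j hij p hp => hp.mono (ENNReal.inv_le_inv.2 (by gcongr))) h1η (by
      intro p hp
      obtain ⟨c, hc, hcp⟩ := hclose p.1 p.2 hp
      obtain ⟨j, hj⟩ := ENNReal.exists_inv_nat_lt hc.ne'
      exact Set.mem_iUnion.2 ⟨j, hcp.mono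
        ((ENNReal.inv_le_inv.2 le_self_add).trans hj.le)⟩)
  set c : ℝ≥0∞ := ((j : ℝ≥0∞) + 1)⁻¹
  have hc : c ≠ 0 := by simp [c]
  have hc' : c ≠ ∞ := by simp [c]
  obtain ⟨G, hG, hGη, ε, hε, hGε⟩ := hd.exists_almost_modulus hdc μ hz hzi hδ
    (mul_ne_zero hc hη)
  obtain ⟨n, hn⟩ := exists_lt_measure_of_subset_iUnion
    (A := fun m : ℕ => {p : E × E | ∀ n ≥ m, CloseAtTime d P c ε n p.1 p.2})
    (fun i j hij p hp n hnj => hp n (hij.trans hnj)) hj (by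
      intro p hp
      exact Set.mem_iUnion.2 (eventually_atTop.1 (hp ε hε)))
  set A : Set E := {x | c < chainLawFrom P x {ω | ω n ∈ Gᶜ}}
  set D : Set E := {x | ¬ ∀ᵐ ω ∂(chainLawFrom P x), z (ω n) = w n x}
  set B : Set (E × E) := {p | δ < |w n p.1 - w n p.2|}
  have hB : MeasurableSet B := measurableSet_lt measurable_const (by fun_prop)
  have hAD : μ (A ∪ D) ≤ η := by
    have h1 : μ D = 0 := ae_chainLawFrom_eval (h n)
    have h2 : μ A ≤ η := measure_lt_chainLawFrom_le hμ hc hc' n hG.compl hGη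
    exact (measure_union_le _ _).trans (by rw [h1, add_zero]; exact h2)
  -- A good pair has nearly equal values of `w n` unless one of its points charges `Gᶜ` too much at
  -- time `n` or lacks the almost sure identity. Each coordinate costs `η`, and the choice of good
  -- pairs costs a third.
  have hsub : {p : E × E | ∀ m ≥ n, CloseAtTime d P c ε m p.1 p.2} ⊆
      Bᶜ ∪ ((A ∪ D) ×ˢ Set.univ ∪ Set.univ ×ˢ (A ∪ D)) := by
    intro p hp
    by_contra hpU
    simp only [Set.mem_union, Set.mem_prod, Set.mem_univ, and_true, true_and, not_or,
      Set.mem_compl_iff, not_not, B, A, D, Set.mem_ofPred_eq, not_lt] at hpU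
    obtain ⟨h1, ⟨h2, h3⟩, h4, h5⟩ := hpU
    exact absurd ((hp n le_rfl).abs_sub_le hG hGε h3 h5 h2 h4) h1
  have hle := (measure_mono (μ := μ.prod μ) hsub).trans ((measure_union_le _ _).trans
    (add_le_add_right (measure_union_le _ _) _))
  rw [Measure.prod_prod, Measure.prod_prod, measure_univ, one_mul, mul_one] at hle
  rw [← prod_measure_abs_sub_eq hμ hz (hw n) (h n) δ]
  -- Adding the mass of `Bᶜ` to both sides avoids a truncated subtraction in `ℝ≥0∞`.
  have hone : (μ.prod μ) B + (μ.prod μ) Bᶜ ≤ 3 * η + (μ.prod μ) Bᶜ := by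
    rw [prob_add_prob_compl hB]
    calc (1 : ℝ≥0∞) ≤ (1 - η) + η := le_tsub_add
      _ ≤ ((μ.prod μ) Bᶜ + (η + η)) + η := by
          gcongr
          exact hn.le.trans (hle.trans (by gcongr))
      _ = 3 * η + (μ.prod μ) Bᶜ := by ring
  exact (ENNReal.add_le_add_iff_right (measure_ne_top _ _)).1 hone

theorem ae_eq_const_of_eval_eq (hd : IsMetric d) (hdc : Continuous fun p : E × E => d p.1 p.2)
    (hμ : Kernel.Invariant P μ) {M : Set (E × E)} (hM : (μ.prod μ) M = 1)
    (hclose : ∀ x y, (x, y) ∈ M → ∃ c > 0, EventuallyClose d P c x y)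
    {z : E → ℝ} {w : ℕ → E → ℝ} (hz : Measurable z) (hzi : Integrable z μ)
    (hw : ∀ n, Measurable (w n)) (h : ∀ n, ∀ᵐ ω ∂(chainLaw P μ), z (ω n) = w n (ω 0)) :
    ∃ a, ∀ᵐ x ∂μ, z x = a := by
  have h0 : ∀ k : ℕ, ∀ᵐ p ∂(μ.prod μ), |z p.1 - z p.2| ≤ 1 / ((k : ℝ) + 1) := by
    intro k
    have h1 : (μ.prod μ) {p | 1 / ((k : ℝ) + 1) < |z p.1 - z p.2|} = 0 := by
      refine nonpos_iff_eq_zero.1 (le_of_forall_pos_le_add fun η hη => ?_)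
      have h3 : (3 : ℝ≥0∞) * (η / 3) = η :=
        ENNReal.mul_div_cancel three_ne_zero ENNReal.ofNat_ne_top
      rw [zero_add, ← h3]
      exact prod_measure_lt_abs_sub_le hd hdc hμ hM hclose hz hzi hw h (by positivity)
        (ENNReal.div_pos hη.ne' ENNReal.ofNat_ne_top).ne'
    filter_upwards [measure_eq_zero_iff_ae_notMem.1 h1] with p hp
    exact not_lt.1 hp
  have h2 : ∀ᵐ p ∂(μ.prod μ), z p.2 = z p.1 := by
    filter_upwards [ae_all_iff.2 h0] with p hp
    have h3 : |z p.1 - z p.2| ≤ 0 :=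
      ge_of_tendsto' tendsto_one_div_add_atTop_nhds_zero_nat hp
    exact (sub_eq_zero.1 (abs_nonpos_iff.1 h3)).symm
  obtain ⟨x, hx⟩ := (Measure.ae_ae_of_ae_prod h2).exists
  exact ⟨z x, hx⟩

theorem tendsto_inner_transL2_pow (hd : IsMetric d)
    (hdc : Continuous fun p : E × E => d p.1 p.2)
    (hμ : Kernel.Invariant P μ) {M : Set (E × E)} (hM : (μ.prod μ) M = 1)
    (hclose : ∀ x y, (x, y) ∈ M → ∃ c > 0, EventuallyClose d P c x y) (f g : Lp ℝ 2 μ) :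
    Tendsto (fun n => inner ℝ f ((transL2 hμ ^ n) g)) atTop
      (𝓝 ((∫ x, f x ∂μ) * ∫ x, g x ∂μ)) := by
  rw [tendsto_iff_ultrafilter]
  intro u hu
  obtain ⟨z, hz, hiso⟩ := exists_weak_limit_isometric (norm_transL2_le hμ) hu g
  obtain ⟨a, ha⟩ := ae_eq_const_of_eval_eq hd hdc hμ hM hclose (z := z)
    (w := fun n => (transL2 hμ ^ n) z) (Lp.stronglyMeasurable z).measurable
    ((Lp.memLp z).integrable one_le_two) (fun n => (Lp.stronglyMeasurable _).measurable)
    (fun n => eval_ae_eq_of_norm_eq hμ (hiso n))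
  have hinner : ∀ h : Lp ℝ 2 μ, inner ℝ z h = (∫ x, h x ∂μ) * a := by
    intro h
    rw [L2.inner_def, ← integral_mul_const]
    refine integral_congr_ae ?_
    filter_upwards [ha] with x hx
    simp [hx]
  have hone := (memLp_const (1 : ℝ) (p := 2) (μ := μ)).coeFn_toLp
  set e : Lp ℝ 2 μ := (memLp_const (1 : ℝ)).toLp _
  -- Testing against the constant `1` identifies `a`: the integral is preserved along the orbit.
  have h1 : ∀ n, inner ℝ ((transL2 hμ ^ n) g) e = ∫ x, g x ∂μ := by
    intro n
    rw [real_inner_comm, inner_transL2_pow,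
      ← integral_eval_chainLaw hμ n (Lp.stronglyMeasurable g)]
    refine integral_congr_ae ?_
    filter_upwards [(measurePreserving_eval_chainLaw hμ 0).quasiMeasurePreserving.ae hone]
      with ω hω
    rw [hω, one_mul]
  have ha' : a = ∫ x, g x ∂μ := by
    have h2 := hz e
    simp only [h1] at h2
    have h3 : ∫ x, e x ∂μ = 1 := by simp [integral_congr_ae hone]
    rw [hinner, h3, one_mul] at h2
    exact tendsto_nhds_unique h2 tendsto_const_nhds
  have h2 := hz f
  rw [hinner, ha'] at h2
  exact h2.congr fun n => real_inner_comm _ _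

theorem isMixing_chainLaw (hd : IsMetric d) (hdc : Continuous fun p : E × E => d p.1 p.2)
    (hμ : Kernel.Invariant P μ) {M : Set (E × E)} (hM : (μ.prod μ) M = 1)
    (hclose : ∀ x y, (x, y) ∈ M → ∃ c > 0, EventuallyClose d P c x y) :
    IsMixing (fun (n : ℕ) (ω : ℕ → E) => ω n) (chainLaw P μ) := by
  refine ⟨isStrictlyStationary_chainLaw hμ, ?_⟩
  rintro f g hf hg ⟨Cf, hCf⟩ ⟨Cg, hCg⟩
  have hfL : MemLp f 2 μ := MemLp.of_bound hf.aestronglyMeasurable Cf (ae_of_all _ hCf)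
  have hgL : MemLp g 2 μ := MemLp.of_bound hg.aestronglyMeasurable Cg (ae_of_all _ hCg)
  have h := tendsto_inner_transL2_pow hd hdc hμ hM hclose (hfL.toLp f) (hgL.toLp g)
  rw [integral_congr_ae hfL.coeFn_toLp, integral_congr_ae hgL.coeFn_toLp] at h
  rw [integral_eval_chainLaw hμ 0 hf.stronglyMeasurable,
    integral_eval_chainLaw hμ 0 hg.stronglyMeasurable]
  refine h.congr fun n => ?_
  rw [inner_transL2_pow]
  refine integral_congr_ae ?_
  filter_upwards [(measurePreserving_eval_chainLaw hμ 0).quasiMeasurePreserving.ae hfL.coeFn_toLp,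
    (measurePreserving_eval_chainLaw hμ n).quasiMeasurePreserving.ae hgL.coeFn_toLp] with ω h1 h2
  rw [h1, h2]

end Main

end GenCoupling

theorem corollary2p6 {E : Type*} [MetricSpace E] [CompleteSpace E]
    [TopologicalSpace.SeparableSpace E] [MeasurableSpace E] [BorelSpace E]
    (d : E → E → ℝ) (hd : GenCoupling.IsMetric d)
    (hd_bdd : ∃ C, ∀ x y, d x y ≤ C)
    (hd_cont : Continuous fun z : E × E => d z.1 z.2)
    (hd_approx : GenCoupling.ApproxOnCompletion hd)
    (P : Kernel E E) [IsMarkovKernel P]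
    (hP : GenCoupling.IsFeller hd P)
    (μ : Measure E) [IsProbabilityMeasure μ]
    (hμ : Kernel.Invariant P μ)
    (M : Set (E × E)) (hM : MeasurableSet M) (hM_one : (μ.prod μ) M = 1)
    (hcond : ∀ x y, (x, y) ∈ M →
      GenCoupling.CouplingCond d P x y ∨ GenCoupling.GenCouplingLpCond d P x y ∨
        GenCoupling.GenCouplingCond d P x y) :
    GenCoupling.IsMixing (fun (n : ℕ) (ω : ℕ → E) => ω n) (GenCoupling.chainLaw P μ) := by
  refine GenCoupling.isMixing_chainLaw hd hd_cont hμ hM_one fun x y hxy => ?_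
  rcases hcond x y hxy with h | h | h
  · exact h.exists_eventuallyClose
  · exact h.exists_eventuallyClose
  · exact h.exists_eventuallyClose
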